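/- Let $n\ge 0$ be an integer and let $Y(n)=Y(\mathfrak{gl}_n)$ be the Yangian, that is, the unital associative $\mathbb{C}$-algebra with generators $t_{ij}^{(r)}$, $1\le i,j\le n$, $r\ge 1$, and defining relations $$[t^{(r+1)}_{ij}, t^{(s)}_{kl}]-[t^{(r)}_{ij}, t^{(s+1)}_{kl}]=t^{(r)}_{kj} t^{(s)}_{il}-t^{(s)}_{kj} t^{(r)}_{il},\qquad 1\le i,j,k,l\le n,\ r,s\ge 0,$$ where $t^{(0)}_{ij}=\delta_{ij}$. Put $t_{ij}(u)=\sum_{r\ge 0}t_{ij}^{(r)}u^{-r}\in Y(n)[[u^{-1}]]$ and let $T(u)=(t_{ij}(u))_{i,j=1}^n$, an $n\times n$ matrix over $Y(n)[[u^{-1}]]$. Maps defined on $Y(n)$ are applied to series coefficientwise and to matrices entrywise. **Theorem.** The algebra $Y(n)$ carries the structure of a Hopf algebra over $\mathbb{C}$ (so the coproduct $\Delta$ and the counit $\epsilon$ are algebra homomorphisms) such that the antipode $\mathrm{S}$ is an anti-automorphism of $Y(n)$ and - the coproduct $\Delta: Y(n)\to Y(n)\otimes Y(n)$ satisfies $\Delta(t_{ij}(u))=\sum_{a=1}^n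 t_{ia}(u)\otimes t_{aj}(u)$, i.e. $\Delta(t_{ij}^{(r)})=\sum_{a=1}^n\sum_{p+q=r}t_{ia}^{(p)}\otimes t_{aj}^{(q)}$ for all $1\le i,j\le n$ and $r\ge 0$; - the matrix $T(u)$ is invertible and the antipode satisfies $\mathrm{S}(T(u))=T(u)^{-1}$, where $T(u)^{-1}$ is the two-sided inverse; - the counit $\epsilon: Y(n)\to\mathbb{C}$ satisfies $\epsilon(T(u))=1$, the identity matrix. -/

import Mathlib

open scoped TensorProduct

noncomputable section

namespace Yangian

/-- The free algebra on symbols `(i, j, r)`, where `(i, j, r)` stands for the generator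
`t_{ij}^{(r+1)}`. -/
abbrev Free (n : ℕ) : Type := FreeAlgebra ℂ (Fin n × Fin n × ℕ)

/-- The element `t_{ij}^{(r)}` of the free algebra, with the convention
`t_{ij}^{(0)} = δ_{ij}`. -/
def freeGen {n : ℕ} (i j : Fin n) : ℕ → Free n
  | 0 => if i = j then 1 else 0
  | r + 1 => FreeAlgebra.ι ℂ (i, j, r)

/-- The defining relations
`[t_{ij}^{(r+1)}, t_{kl}^{(s)}] - [t_{ij}^{(r)}, t_{kl}^{(s+1)}]
  = t_{kj}^{(r)} t_{il}^{(s)} - t_{kj}^{(s)} t_{il}^{(r)}` for all `r, s ≥ 0`;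
here `⁅a, b⁆ = a * b - b * a`. -/
inductive Rel (n : ℕ) : Free n → Free n → Prop
  | rel (i j k l : Fin n) (r s : ℕ) :
      Rel n
        (⁅freeGen i j (r + 1), freeGen k l s⁆ - ⁅freeGen i j r, freeGen k l (s + 1)⁆)
        (freeGen k j r * freeGen i l s - freeGen k j s * freeGen i l r)

end Yangian

/-- The Yangian `Y(n)` of `gl_n`, as a ring. -/
def Yangian (n : ℕ) : Type := RingQuot (Yangian.Rel n)

namespace Yangian

instance instRing (n : ℕ) : Ring (Yangian n) :=
  inferInstanceAs (Ring (RingQuot (Yangian.Rel n)))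

/-- The `ℂ`-algebra structure of `Y(n)` given by its presentation. It is not registered as an
instance: a Hopf algebra structure carries an algebra structure, and is required to carry
this one. -/
abbrev algebra (n : ℕ) : Algebra ℂ (Yangian n) :=
  inferInstanceAs (Algebra ℂ (RingQuot (Yangian.Rel n)))

/-- The element `t_{ij}^{(r)}` of `Y(n)`, for `r ≥ 0`. -/
def gen {n : ℕ} (i j : Fin n) (r : ℕ) : Yangian n :=
  RingQuot.mkRingHom (Yangian.Rel n) (freeGen i j r)

/-- The matrix `T(u)`, whose `(i, j)` entry is the formal series
`t_{ij}(u) = ∑_{r ≥ 0} t_{ij}^{(r)} u^{-r}`. The variable of `PowerSeries` stands for `u⁻¹`. -/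
def T (n : ℕ) : Matrix (Fin n) (Fin n) (PowerSeries (Yangian n)) :=
  Matrix.of fun i j => PowerSeries.mk fun r => gen i j r

end Yangian

/-- Apply a map `f : A → B` to each coefficient of each entry of a matrix of formal series. -/
def Matrix.mapCoeff {n : ℕ} {A B : Type} [Semiring A] (f : A → B)
    (M : Matrix (Fin n) (Fin n) (PowerSeries A)) : Matrix (Fin n) (Fin n) (PowerSeries B) :=
  Matrix.of fun i j => PowerSeries.mk fun r => f (PowerSeries.coeff r (M i j))

end

/-! With `c = v⁻¹ - u⁻¹` and `d = u⁻¹v⁻¹`, the defining relations become the `RTT` relation `R T₁(u)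
T₂(v) = T₂(v) T₁(u) R`, where `R = c - dP` has central coefficients (`exchange_iff`,
`X_sub_varX_mul_eq_iff`). By `lift` and `mapT_injective`, algebra maps `Y(n) → B` correspond to
matrices of series over `B` satisfying `IsRTT`, so each structure map is a solution and each
identity of algebra maps is an identity of matrices.

A product of two solutions with mutually commuting entries is a solution (`IsRTT.mul`); this gives
the coproduct. The identity matrix gives the counit. Inverting both sides of `RTT` shows that
`T(u)⁻¹` is a solution over the opposite algebra (`IsRTT.op_inv`); this gives the antipode `S` as an
anti-homomorphism.

`S` is bijective because `T(u) ↦ T(-u)` is an involutive anti-automorphism whose composite with `S`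
is the involution `T(u) ↦ T(-u)⁻¹`. The antipode axioms pass from two elements to their product, and
on generators they are the entries of `T⁻¹T = 1` and `TT⁻¹ = 1`. -/

noncomputable section

namespace Yangian

/-! ### The `RTT` relation over an arbitrary ring -/

section Exchange

variable {ι A : Type*} [Fintype ι] [DecidableEq ι] [Ring A]

/-- The quadratic exchange relation `c [X_{ij}, Y_{kl}] = d (X_{kj} Y_{il} - Y_{kj} X_{il})`
between the entries of two square matrices. -/
def Exchange (c d : A) (X Y : Matrix ι ι A) : Prop :=
  ∀ i j k l, c * (X i j * Y k l - Y k l * X i j) = d * (X k j * Y i l - Y k j * X i l)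

/-- The matrix `X ⊗ 1` acting on the first tensor factor. -/
def leftFactor (X : Matrix ι ι A) : Matrix (ι × ι) (ι × ι) A :=
  Matrix.blockDiagonal fun _ => X

/-- The matrix `1 ⊗ X` acting on the second tensor factor. -/
def rightFactor (X : Matrix ι ι A) : Matrix (ι × ι) (ι × ι) A :=
  (leftFactor X).submatrix (Equiv.prodComm ι ι) (Equiv.prodComm ι ι)

/-- The `R`-matrix `c - d P`, where `P` is the flip of the two tensor factors. -/
def rMatrix (ι : Type*) [Fintype ι] [DecidableEq ι] (c d : A) : Matrix (ι × ι) (ι × ι) A :=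
  Matrix.diagonal (fun _ => c) -
    Matrix.diagonal (fun _ => d) * (1 : Matrix (ι × ι) (ι × ι) A).submatrix Prod.swap id

theorem leftFactor_mul (X Y : Matrix ι ι A) :
    leftFactor (X * Y) = leftFactor X * leftFactor Y :=
  Matrix.blockDiagonal_mul _ _

omit [Fintype ι] in
theorem leftFactor_one : leftFactor (1 : Matrix ι ι A) = 1 :=
  Matrix.blockDiagonal_one

theorem rightFactor_mul (X Y : Matrix ι ι A) :
    rightFactor (X * Y) = rightFactor X * rightFactor Y := by
  rw [rightFactor, leftFactor_mul, rightFactor, rightFactor, Matrix.submatrix_mul_equiv]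

omit [Fintype ι] in
theorem rightFactor_one : rightFactor (1 : Matrix ι ι A) = 1 := by
  rw [rightFactor, leftFactor_one, Matrix.submatrix_one_equiv]

theorem leftFactor_mul_rightFactor_apply (X Y : Matrix ι ι A) (i j k l : ι) :
    (leftFactor X * rightFactor Y) (i, k) (j, l) = X i j * Y k l := by
  simp [leftFactor, rightFactor, Matrix.mul_apply, Fintype.sum_prod_type,
    Matrix.blockDiagonal_apply]

theorem rightFactor_mul_leftFactor_apply (X Y : Matrix ι ι A) (i j k l : ι) :
    (rightFactor Y * leftFactor X) (i, k) (j, l) = Y k l * X i j := by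
  simp [leftFactor, rightFactor, Matrix.mul_apply, Fintype.sum_prod_type,
    Matrix.blockDiagonal_apply]

theorem leftFactor_rightFactor_comm {X Y : Matrix ι ι A}
    (h : ∀ i j k l, Commute (X i j) (Y k l)) :
    leftFactor X * rightFactor Y = rightFactor Y * leftFactor X := by
  ext ⟨i, k⟩ ⟨j, l⟩
  rw [leftFactor_mul_rightFactor_apply, rightFactor_mul_leftFactor_apply, (h i j k l).eq]

theorem rMatrix_mul_apply (c d : A) (M : Matrix (ι × ι) (ι × ι) A) (i j k l : ι) :
    (rMatrix ι c d * M) (i, k) (j, l) = c * M (i, k) (j, l) - d * M (k, i) (j, l) := by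
  rw [rMatrix, sub_mul, Matrix.sub_apply, Matrix.diagonal_mul, mul_assoc, Matrix.diagonal_mul]
  simp [Matrix.mul_apply, Matrix.one_apply]

/-- Multiplying by `P` on the right permutes columns, on the left rows. Centrality of `c` and `d`
moves the scalars to the front, so that both sides of `RTT` can be compared entrywise. -/
theorem mul_rMatrix_apply {c d : A} (hc : ∀ a, Commute c a) (hd : ∀ a, Commute d a)
    (M : Matrix (ι × ι) (ι × ι) A) (i j k l : ι) :
    (M * rMatrix ι c d) (i, k) (j, l) = c * M (i, k) (j, l) - d * M (i, k) (l, j) := by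
  rw [rMatrix, mul_sub, Matrix.sub_apply, Matrix.mul_diagonal, ← mul_assoc, (hc _).eq, (hd _).eq]
  congr 1
  rw [Matrix.mul_apply, Finset.sum_eq_single (l, j)]
  · simp [Matrix.mul_diagonal, Matrix.one_apply]
  · rintro ⟨a, b⟩ - hab
    have : ¬ (b = j ∧ a = l) := fun h => hab (by rw [h.1, h.2])
    simp [this]
  · simp

/-- The exchange relation is the `RTT` relation. -/
theorem exchange_iff {c d : A} (hc : ∀ a, Commute c a) (hd : ∀ a, Commute d a)
    (X Y : Matrix ι ι A) :
    Exchange c d X Y ↔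
      rMatrix ι c d * (leftFactor X * rightFactor Y) =
        rightFactor Y * leftFactor X * rMatrix ι c d := by
  rw [← Matrix.ext_iff]
  simp only [Prod.forall, rMatrix_mul_apply, mul_rMatrix_apply hc hd,
    leftFactor_mul_rightFactor_apply, rightFactor_mul_leftFactor_apply, Exchange, mul_sub]
  constructor
  · intro h i k j l
    rw [sub_eq_sub_iff_sub_eq_sub, h i j k l]
  · intro h i j k l
    rw [sub_eq_sub_iff_sub_eq_sub, h i k j l]

/-- The product of two commuting solutions of the exchange relation is a solution. -/
theorem Exchange.mul {c d : A} (hc : ∀ a, Commute c a) (hd : ∀ a, Commute d a)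
    {X Y X' Y' : Matrix ι ι A} (h : Exchange c d X Y) (h' : Exchange c d X' Y')
    (hXY : ∀ i j k l, Commute (X i j) (Y' k l)) (hYX : ∀ i j k l, Commute (X' i j) (Y k l)) :
    Exchange c d (X * X') (Y * Y') := by
  rw [exchange_iff hc hd] at *
  have h₁ := leftFactor_rightFactor_comm hXY
  have h₂ := leftFactor_rightFactor_comm hYX
  rw [leftFactor_mul, rightFactor_mul]
  -- Swap the two inner factors, move `R` past each pair in turn, then swap back.
  calc rMatrix ι c d * (leftFactor X * leftFactor X' * (rightFactor Y * rightFactor Y'))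
      = rMatrix ι c d * (leftFactor X * (leftFactor X' * rightFactor Y) * rightFactor Y') := by
        simp only [mul_assoc]
    _ = rMatrix ι c d * (leftFactor X * rightFactor Y) * (leftFactor X' * rightFactor Y') := by
        rw [h₂]; simp only [mul_assoc]
    _ = rightFactor Y * leftFactor X * (rMatrix ι c d * (leftFactor X' * rightFactor Y')) := by
        rw [h]; simp only [mul_assoc]
    _ = rightFactor Y * (leftFactor X * rightFactor Y') * leftFactor X' * rMatrix ι c d := by
        rw [h']; simp only [mul_assoc]
    _ = rightFactor Y * rightFactor Y' * (leftFactor X * leftFactor X') * rMatrix ι c d := by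
        rw [h₁]; simp only [mul_assoc]

/-- The inverses of a solution of the exchange relation satisfy the relation with the opposite
multiplication. -/
theorem Exchange.inv {c d : A} (hc : ∀ a, Commute c a) (hd : ∀ a, Commute d a)
    {X Y X' Y' : Matrix ι ι A} (h : Exchange c d X Y) (hX : X * X' = 1) (hX' : X' * X = 1)
    (hY : Y * Y' = 1) (hY' : Y' * Y = 1) (i j k l : ι) :
    c * (Y' k l * X' i j - X' i j * Y' k l) = d * (Y' i l * X' k j - X' i l * Y' k j) := by
  rw [exchange_iff hc hd] at h
  have e₁ : leftFactor X * leftFactor X' = 1 := by rw [← leftFactor_mul, hX, leftFactor_one]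
  have e₂ : leftFactor X' * leftFactor X = 1 := by rw [← leftFactor_mul, hX', leftFactor_one]
  have e₃ : rightFactor Y * rightFactor Y' = 1 := by rw [← rightFactor_mul, hY, rightFactor_one]
  have e₄ : rightFactor Y' * rightFactor Y = 1 := by rw [← rightFactor_mul, hY', rightFactor_one]
  -- Multiply `RTT` by the inverses on both sides; `R` itself need not be invertible.
  have key : rMatrix ι c d * (rightFactor Y' * leftFactor X') =
      leftFactor X' * rightFactor Y' * rMatrix ι c d := by
    calc rMatrix ι c d * (rightFactor Y' * leftFactor X')
        = leftFactor X' * ((rightFactor Y' * rightFactor Y) * leftFactor X) * rMatrix ι c d *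
            (rightFactor Y' * leftFactor X') := by
          rw [e₄, one_mul, e₂, one_mul]
      _ = leftFactor X' * rightFactor Y' * (rightFactor Y * leftFactor X * rMatrix ι c d) *
            (rightFactor Y' * leftFactor X') := by simp only [mul_assoc]
      _ = leftFactor X' * rightFactor Y' * rMatrix ι c d *
            (leftFactor X * ((rightFactor Y * rightFactor Y') * leftFactor X')) := by
          rw [← h]; simp only [mul_assoc]
      _ = leftFactor X' * rightFactor Y' * rMatrix ι c d := by
          rw [e₃, one_mul, e₁, mul_one]
  have := congrFun₂ key (i, k) (j, l)
  rw [rMatrix_mul_apply, mul_rMatrix_apply hc hd, leftFactor_mul_rightFactor_apply,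
    leftFactor_mul_rightFactor_apply, rightFactor_mul_leftFactor_apply,
    rightFactor_mul_leftFactor_apply] at this
  rw [mul_sub, mul_sub, sub_eq_sub_iff_sub_eq_sub, this]

end Exchange

/-! ### Series in two variables: the outer `X` is `v⁻¹`, the inner one `u⁻¹` -/

section Series

open PowerSeries

variable {R : Type*} [Ring R]

/-- The formal variable `u⁻¹` of the two-variable series. -/
def varX : R⟦X⟧⟦X⟧ := C X

/-- The series `f(u)` as a two-variable series. -/
def inX : R⟦X⟧ →+* R⟦X⟧⟦X⟧ := C

/-- The series `f(v)` as a two-variable series. -/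
def inY : R⟦X⟧ →+* R⟦X⟧⟦X⟧ := PowerSeries.map C

theorem coeff_inX_mul_inY (f g : R⟦X⟧) (r s : ℕ) :
    coeff r (coeff s (inX f * inY g)) = coeff r f * coeff s g := by
  simp [inX, inY]

theorem coeff_inY_mul_inX (f g : R⟦X⟧) (r s : ℕ) :
    coeff r (coeff s (inY g * inX f)) = coeff s g * coeff r f := by
  simp [inX, inY]

theorem commute_inX_inY {f g : R⟦X⟧} (h : ∀ r s, Commute (coeff r f) (coeff s g)) :
    Commute (inX f) (inY g) := by
  ext s r
  rw [coeff_inX_mul_inY, coeff_inY_mul_inX, (h r s).eq]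

theorem commute_varX (a : R⟦X⟧⟦X⟧) : Commute varX a := by
  ext s r
  rw [varX, coeff_C_mul, coeff_mul_C, (commute_X (coeff s a)).eq]

theorem commute_X_sub_varX (a : R⟦X⟧⟦X⟧) : Commute (X - varX) a :=
  (commute_X a).symm.sub_left (commute_varX a)

theorem commute_varX_mul_X (a : R⟦X⟧⟦X⟧) : Commute (varX * X) a :=
  (commute_varX a).mul_left (commute_X a).symm

/-- Comparison of coefficients in `(v⁻¹ - u⁻¹) F = u⁻¹ v⁻¹ G`. -/
theorem X_sub_varX_mul_eq_iff (F G : R⟦X⟧⟦X⟧) :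
    (X - varX) * F = varX * X * G ↔
      (∀ r, coeff r (coeff 0 F) = 0) ∧ (∀ s, coeff 0 (coeff s F) = 0) ∧
        ∀ r s, coeff (r + 1) (coeff s F) - coeff r (coeff (s + 1) F) =
          coeff r (coeff s G) := by
  rw [PowerSeries.ext_iff]
  simp only [PowerSeries.ext_iff (R := R)]
  simp only [sub_mul, mul_assoc, varX, map_sub, coeff_C_mul]
  constructor
  -- In degree 0 in `u⁻¹` or in `v⁻¹` the right side vanishes and only one term on the left
  -- survives; this yields the two boundary conditions.
  · intro h
    refine ⟨fun r => ?_, fun s => ?_, fun r s => ?_⟩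
    · simpa [coeff_zero_X_mul, coeff_succ_X_mul] using h 0 (r + 1)
    · simpa [coeff_zero_X_mul, coeff_succ_X_mul] using h (s + 1) 0
    · simpa [coeff_zero_X_mul, coeff_succ_X_mul] using h (s + 1) (r + 1)
  · rintro ⟨h₁, h₂, h₃⟩ (_ | s) (_ | r)
    · simp
    · simpa [coeff_zero_X_mul, coeff_succ_X_mul] using h₁ r
    · simpa [coeff_zero_X_mul, coeff_succ_X_mul] using h₂ s
    · simpa [coeff_zero_X_mul, coeff_succ_X_mul] using h₃ r s

variable {n : ℕ}

/-- A matrix of series with constant term `1` whose coefficients satisfy the defining relations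
of the Yangian. -/
structure IsRTT (M : Matrix (Fin n) (Fin n) R⟦X⟧) : Prop where
  coeff_zero : ∀ i j, coeff 0 (M i j) = (1 : Matrix (Fin n) (Fin n) R) i j
  rel : ∀ i j k l r s,
    ⁅coeff (r + 1) (M i j), coeff s (M k l)⁆ - ⁅coeff r (M i j), coeff (s + 1) (M k l)⁆ =
      coeff r (M k j) * coeff s (M i l) - coeff s (M k j) * coeff r (M i l)

theorem IsRTT.map {S : Type*} [Ring S] {M : Matrix (Fin n) (Fin n) R⟦X⟧} (h : IsRTT M)
    (f : R →+* S) : IsRTT ((PowerSeries.map f).mapMatrix M) where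
  coeff_zero i j := by
    have := congrArg f (h.coeff_zero i j)
    simp only [RingHom.mapMatrix_apply, Matrix.map_apply, coeff_map, this]
    simp [Matrix.one_apply, apply_ite f]
  rel i j k l r s := by
    have := congrArg f (h.rel i j k l r s)
    simpa only [Ring.lie_def, map_sub, map_mul, RingHom.mapMatrix_apply, Matrix.map_apply,
      coeff_map] using this

theorem IsRTT.exchange {M : Matrix (Fin n) (Fin n) R⟦X⟧} (h : IsRTT M) :
    Exchange (X - varX) (varX * X) (inX.mapMatrix M) (inY.mapMatrix M) := by
  -- The constant terms are 0 or 1, hence central, so the commutators satisfy the boundary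
  -- conditions of `X_sub_varX_mul_eq_iff`.
  have hc (i j : Fin n) (a : R) : Commute (coeff 0 (M i j)) a := by
    rw [h.coeff_zero, Matrix.one_apply]
    split_ifs
    exacts [Commute.one_left a, Commute.zero_left a]
  intro i j k l
  rw [X_sub_varX_mul_eq_iff]
  simp only [RingHom.mapMatrix_apply, Matrix.map_apply, map_sub, coeff_inX_mul_inY,
    coeff_inY_mul_inX]
  exact ⟨fun r => by rw [(hc k l _).eq, sub_self], fun s => by rw [(hc i j _).eq, sub_self],
    h.rel i j k l⟩

theorem IsRTT.of_exchange {M : Matrix (Fin n) (Fin n) R⟦X⟧}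
    (h₀ : ∀ i j, coeff 0 (M i j) = (1 : Matrix (Fin n) (Fin n) R) i j)
    (h : Exchange (X - varX) (varX * X) (inX.mapMatrix M) (inY.mapMatrix M)) : IsRTT M where
  coeff_zero := h₀
  rel i j k l := by
    have := ((X_sub_varX_mul_eq_iff _ _).1 (h i j k l)).2.2
    simpa only [Ring.lie_def, RingHom.mapMatrix_apply, Matrix.map_apply, map_sub, coeff_inX_mul_inY,
      coeff_inY_mul_inX] using this

theorem coeff_zero_apply (M : Matrix (Fin n) (Fin n) R⟦X⟧) (i j : Fin n) :
    coeff 0 (M i j) = (constantCoeff (R := R)).mapMatrix M i j := by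
  simp

theorem isRTT_one : IsRTT (1 : Matrix (Fin n) (Fin n) R⟦X⟧) := by
  refine .of_exchange (fun i j => by rw [coeff_zero_apply, map_one]) fun i j k l => ?_
  rw [map_one, map_one, sub_self]
  simp only [Matrix.one_apply]
  split_ifs <;> simp

/-- The product of two commuting solutions of the `RTT` relation is a solution. -/
theorem IsRTT.mul {M N : Matrix (Fin n) (Fin n) R⟦X⟧} (hM : IsRTT M) (hN : IsRTT N)
    (h : ∀ i j k l r s, Commute (coeff r (M i j)) (coeff s (N k l))) : IsRTT (M * N) := by
  refine .of_exchange (fun i j => ?_) ?_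
  · have h₁ : (constantCoeff (R := R)).mapMatrix M = 1 := by
      ext i j; rw [← coeff_zero_apply, hM.coeff_zero]
    have h₂ : (constantCoeff (R := R)).mapMatrix N = 1 := by
      ext i j; rw [← coeff_zero_apply, hN.coeff_zero]
    rw [coeff_zero_apply, map_mul, h₁, h₂, one_mul]
  · rw [map_mul, map_mul]
    exact hM.exchange.mul commute_X_sub_varX commute_varX_mul_X hN.exchange
      (fun i j k l => commute_inX_inY (h i j k l))
      (fun i j k l => commute_inX_inY fun r s => (h k l i j s r).symm)

open MulOpposite in
/-- The inverse of a solution of the `RTT` relation, with the opposite multiplication, is a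
solution. -/
theorem IsRTT.op_inv {M N : Matrix (Fin n) (Fin n) R⟦X⟧} (hM : IsRTT M) (h : M * N = 1)
    (h' : N * M = 1) :
    IsRTT (Matrix.of fun i j => PowerSeries.mk fun r => op (coeff r (N i j)) :
      Matrix (Fin n) (Fin n) Rᵐᵒᵖ⟦X⟧) where
  coeff_zero i j := by
    have h₁ : (constantCoeff (R := R)).mapMatrix M = 1 := by
      ext i j; rw [← coeff_zero_apply, hM.coeff_zero]
    have h₂ := congrArg (constantCoeff (R := R)).mapMatrix h
    rw [map_mul, h₁, one_mul, map_one] at h₂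
    rw [Matrix.of_apply, coeff_mk, coeff_zero_apply, h₂, Matrix.one_apply, Matrix.one_apply]
    split_ifs <;> rfl
  rel i j k l r s := by
    -- Read with the opposite product, the conclusion of `Exchange.inv` is again the exchange
    -- relation.
    have := ((X_sub_varX_mul_eq_iff _ _).1 (hM.exchange.inv commute_X_sub_varX commute_varX_mul_X
      (X' := inX.mapMatrix N) (Y' := inY.mapMatrix N) (by rw [← map_mul, h, map_one])
      (by rw [← map_mul, h', map_one]) (by rw [← map_mul, h, map_one])
      (by rw [← map_mul, h', map_one]) i j k l)).2.2 r s
    simp only [RingHom.mapMatrix_apply, Matrix.map_apply, map_sub, coeff_inX_mul_inY,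
      coeff_inY_mul_inX] at this
    simp only [Matrix.of_apply, coeff_mk, Ring.lie_def, ← op_mul, ← op_sub, this]

open MulOpposite in
/-- A solution of the `RTT` relation at `-u`, with the opposite multiplication, is a solution. -/
theorem IsRTT.op_neg {M : Matrix (Fin n) (Fin n) R⟦X⟧} (hM : IsRTT M) :
    IsRTT (Matrix.of fun i j => PowerSeries.mk fun r => op ((-1) ^ r * coeff r (M i j)) :
      Matrix (Fin n) (Fin n) Rᵐᵒᵖ⟦X⟧) where
  coeff_zero i j := by
    rw [Matrix.of_apply, coeff_mk, hM.coeff_zero, pow_zero, one_mul, Matrix.one_apply,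
      Matrix.one_apply]
    split_ifs <;> rfl
  rel i j k l r s := by
    -- Exchanging `(i, j, r)` with `(k, l, s)` fixes the left side and reverses the products on the
    -- right.
    have h₁ := hM.rel k l i j s r
    simp only [Ring.lie_def] at h₁
    simp only [Matrix.of_apply, coeff_mk, Ring.lie_def, ← op_mul, ← op_sub]
    congr 1
    have hs (r s : ℕ) (a b : R) :
        ((-1) ^ r * a) * ((-1) ^ s * b) = (-1) ^ (r + s) * (a * b) := by
      rw [pow_add, mul_assoc, mul_assoc, ← mul_assoc a, ← mul_assoc _ a b,
        ((Commute.neg_one_left a).pow_left s).eq]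
    simp only [hs]
    -- The left side has total degree one higher than the right; the extra sign cancels the one that
    -- commutators acquire in the opposite ring.
    rw [show r + 1 + s = r + s + 1 by ring, show s + (r + 1) = r + s + 1 by ring,
      show s + 1 + r = r + s + 1 by ring, show r + (s + 1) = r + s + 1 by ring, add_comm s r]
    rw [pow_succ, mul_neg_one]
    simp only [neg_mul, sub_neg_eq_add, neg_add_eq_sub, ← mul_sub]
    congr 1
    rw [← h₁]
    abel

/-! ### Invertibility of matrices of series -/

/-- A matrix of series as a series of matrices. -/
def toSeries (M : Matrix (Fin n) (Fin n) R⟦X⟧) : (Matrix (Fin n) (Fin n) R)⟦X⟧ :=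
  PowerSeries.mk fun r => M.map (coeff r)

theorem coeff_toSeries (M : Matrix (Fin n) (Fin n) R⟦X⟧) (r : ℕ) :
    coeff r (toSeries M) = M.map (coeff r) :=
  coeff_mk _ _

theorem toSeries_injective : Function.Injective (toSeries (R := R) (n := n)) := by
  intro M N h
  ext i j r
  have := congrArg (coeff r) h
  rw [coeff_toSeries, coeff_toSeries, ← Matrix.ext_iff] at this
  exact this i j

theorem toSeries_surjective : Function.Surjective (toSeries (R := R) (n := n)) := by
  intro φ
  refine ⟨Matrix.of fun i j => PowerSeries.mk fun r => (coeff r φ) i j, ?_⟩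
  ext r i j
  simp [coeff_toSeries]

theorem toSeries_one : toSeries (1 : Matrix (Fin n) (Fin n) R⟦X⟧) = 1 := by
  ext r i j
  rw [coeff_toSeries, coeff_one, Matrix.map_apply, Matrix.one_apply]
  split_ifs with h₁ h₂ h₂ <;> simp [coeff_one, h₁, h₂, Matrix.one_apply]

theorem toSeries_mul (M N : Matrix (Fin n) (Fin n) R⟦X⟧) :
    toSeries (M * N) = toSeries M * toSeries N := by
  ext r i j
  simp only [coeff_toSeries, coeff_mul, Matrix.map_apply, Matrix.mul_apply, map_sum,
    Matrix.sum_apply]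
  exact Finset.sum_comm

/-- A matrix of series with constant term `1` is invertible. -/
theorem exists_inverse (M : Matrix (Fin n) (Fin n) R⟦X⟧)
    (h₀ : ∀ i j, coeff 0 (M i j) = (1 : Matrix (Fin n) (Fin n) R) i j) :
    ∃ N : Matrix (Fin n) (Fin n) R⟦X⟧, M * N = 1 ∧ N * M = 1 := by
  have hM : constantCoeff (toSeries M) = ((1 : (Matrix (Fin n) (Fin n) R)ˣ) : Matrix _ _ R) := by
    ext i j
    rw [← coeff_zero_eq_constantCoeff_apply, coeff_toSeries, Matrix.map_apply, h₀, Units.val_one]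
  -- As a series over the matrix ring, `M` has constant term 1 and is therefore invertible.
  obtain ⟨N, hN⟩ := toSeries_surjective (invOfUnit (toSeries M) 1)
  refine ⟨N, toSeries_injective ?_, toSeries_injective ?_⟩
  · rw [toSeries_mul, hN, mul_invOfUnit _ _ hM, toSeries_one]
  · rw [toSeries_mul, hN, invOfUnit_mul _ _ hM, toSeries_one]

end Series

open PowerSeries

theorem coeff_mapCoeff {n : ℕ} {A B : Type} [Semiring A] [Semiring B] (f : A → B)
    (M : Matrix (Fin n) (Fin n) A⟦X⟧) (i j : Fin n) (r : ℕ) :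
    coeff r (Matrix.mapCoeff f M i j) = f (coeff r (M i j)) := by
  rw [Matrix.mapCoeff, Matrix.of_apply, coeff_mk]

/-! ### The substitution `u ↦ -u` -/

section EvalNeg

variable {R : Type*} [Ring R]

theorem neg_one_pow_mul_self (r : ℕ) (x : R) : (-1) ^ r * ((-1) ^ r * x) = x := by
  rw [← mul_assoc, ← pow_add, Even.neg_one_pow ⟨r, rfl⟩, one_mul]

/-- The substitution `f(u) ↦ f(-u)`. -/
def evalNeg : R⟦X⟧ →+* R⟦X⟧ where
  toFun f := PowerSeries.mk fun r => (-1) ^ r * coeff r f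
  map_zero' := by ext; simp
  map_one' := by
    ext r
    rcases r with _ | r <;> simp [coeff_one]
  map_add' f g := by ext; simp [mul_add]
  map_mul' f g := by
    ext r
    rw [coeff_mk, coeff_mul, coeff_mul, Finset.mul_sum]
    refine Finset.sum_congr rfl fun p hp => ?_
    rw [coeff_mk, coeff_mk, ← Finset.HasAntidiagonal.mem_antidiagonal.1 hp, pow_add, mul_assoc,
      mul_assoc, ← mul_assoc (coeff p.1 f), ← ((Commute.neg_one_left _).pow_left p.2).eq, mul_assoc]

theorem coeff_evalNeg (f : R⟦X⟧) (r : ℕ) : coeff r (evalNeg f) = (-1) ^ r * coeff r f := by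
  rw [evalNeg, RingHom.coe_mk, MonoidHom.coe_mk, OneHom.coe_mk, coeff_mk]

theorem evalNeg_evalNeg (f : R⟦X⟧) : evalNeg (evalNeg f) = f := by
  ext r
  rw [coeff_evalNeg, coeff_evalNeg, neg_one_pow_mul_self]

theorem map_evalNeg {S : Type*} [Ring S] (φ : R →+* S) (f : R⟦X⟧) :
    PowerSeries.map φ (evalNeg f) = evalNeg (PowerSeries.map φ f) := by
  ext r
  simp [coeff_evalNeg]

theorem mapMatrix_evalNeg_evalNeg {n : ℕ} (M : Matrix (Fin n) (Fin n) R⟦X⟧) :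
    evalNeg.mapMatrix (evalNeg.mapMatrix M) = M := by
  ext i j : 1
  exact evalNeg_evalNeg _

end EvalNeg

/-! ### The universal property of the Yangian -/

section Lift

attribute [local instance] Yangian.algebra

variable {n : ℕ}

/-- The quotient map from the free algebra. -/
def quot (n : ℕ) : Free n →ₐ[ℂ] Yangian n :=
  RingQuot.mkAlgHom ℂ (Rel n)

theorem quot_freeGen (i j : Fin n) (r : ℕ) : quot n (freeGen i j r) = gen i j r :=
  congrArg (fun f : Free n →+* RingQuot (Rel n) => f (freeGen i j r))
    (RingQuot.mkAlgHom_coe ℂ (Rel n))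

theorem quot_rel {x y : Free n} (h : Rel n x y) : quot n x = quot n y :=
  RingQuot.mkAlgHom_rel ℂ h

theorem map_freeGen_zero {S F : Type*} [Semiring S] [FunLike F (Free n) S]
    [RingHomClass F (Free n) S] (f : F) (i j : Fin n) :
    f (freeGen i j 0) = (1 : Matrix (Fin n) (Fin n) S) i j := by
  rw [freeGen, Matrix.one_apply]
  split_ifs
  exacts [map_one f, map_zero f]

theorem coeff_T (i j : Fin n) (r : ℕ) : coeff r (T n i j) = gen i j r := by
  rw [T, Matrix.of_apply, coeff_mk]

theorem isRTT_T (n : ℕ) : IsRTT (T n) where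
  coeff_zero i j := by
    rw [coeff_T, ← quot_freeGen, map_freeGen_zero]
  rel i j k l r s := by
    have := quot_rel (Rel.rel i j k l r s)
    simpa only [Ring.lie_def, coeff_T, map_sub, map_mul, quot_freeGen] using this

variable {B : Type*} [Ring B] [Algebra ℂ B]

/-- The homomorphism on the free algebra that sends `t_{ij}(u)` to the entries of a matrix of
series. -/
def freeLift (M : Matrix (Fin n) (Fin n) B⟦X⟧) : Free n →ₐ[ℂ] B :=
  FreeAlgebra.lift ℂ fun p => coeff (p.2.2 + 1) (M p.1 p.2.1)

theorem freeLift_freeGen {M : Matrix (Fin n) (Fin n) B⟦X⟧} (hM : IsRTT M) (i j : Fin n) (r : ℕ) :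
    freeLift M (freeGen i j r) = coeff r (M i j) := by
  cases r with
  | zero => rw [map_freeGen_zero, hM.coeff_zero]
  | succ r => exact FreeAlgebra.lift_ι_apply _ _

theorem freeLift_rel {M : Matrix (Fin n) (Fin n) B⟦X⟧} (hM : IsRTT M) ⦃x y : Free n⦄
    (h : Rel n x y) : freeLift M x = freeLift M y := by
  obtain ⟨i, j, k, l, r, s⟩ := h
  simpa only [Ring.lie_def, map_sub, map_mul, freeLift_freeGen hM] using hM.rel i j k l r s

/-- The algebra homomorphism on the Yangian that sends `T(u)` to a given solution of the `RTT`
relation. -/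
def lift (M : Matrix (Fin n) (Fin n) B⟦X⟧) (hM : IsRTT M) : Yangian n →ₐ[ℂ] B :=
  RingQuot.liftAlgHom ℂ (s := Rel n) ⟨freeLift M, freeLift_rel hM⟩

theorem lift_gen (M : Matrix (Fin n) (Fin n) B⟦X⟧) (hM : IsRTT M) (i j : Fin n) (r : ℕ) :
    lift M hM (gen i j r) = coeff r (M i j) := by
  rw [← quot_freeGen, ← freeLift_freeGen hM]
  exact RingQuot.liftAlgHom_mkAlgHom_apply ℂ _ (freeLift_rel hM) _

theorem algHom_ext {f g : Yangian n →ₐ[ℂ] B}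
    (h : ∀ i j r, f (gen i j r) = g (gen i j r)) : f = g := by
  refine RingQuot.ringQuot_ext' ℂ f g (FreeAlgebra.hom_ext (funext fun ⟨i, j, r⟩ => ?_))
  have := h i j (r + 1)
  rwa [← quot_freeGen] at this

/-- The image of `T(u)` under an algebra homomorphism. -/
def mapT (f : Yangian n →ₐ[ℂ] B) : Matrix (Fin n) (Fin n) B⟦X⟧ :=
  (PowerSeries.map (f : Yangian n →+* B)).mapMatrix (T n)

theorem coeff_mapT (f : Yangian n →ₐ[ℂ] B) (i j : Fin n) (r : ℕ) :
    coeff r (mapT f i j) = f (gen i j r) := by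
  simp [mapT, coeff_T]

/-- Reduces coassociativity, the counit laws and `invNeg_invNeg` to matrix identities. -/
theorem mapT_injective : Function.Injective (mapT (n := n) (B := B)) := by
  intro f g h
  refine algHom_ext fun i j r => ?_
  rw [← coeff_mapT, h, coeff_mapT]

theorem isRTT_mapT (f : Yangian n →ₐ[ℂ] B) : IsRTT (mapT f) :=
  (isRTT_T n).map _

theorem mapT_lift (M : Matrix (Fin n) (Fin n) B⟦X⟧) (hM : IsRTT M) : mapT (lift M hM) = M := by
  ext i j r
  rw [coeff_mapT, lift_gen]

theorem mapT_id : mapT (AlgHom.id ℂ (Yangian n)) = T n := by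
  ext i j r
  rw [coeff_mapT, coeff_T, AlgHom.id_apply]

theorem mapT_comp {C : Type*} [Ring C] [Algebra ℂ C] (g : B →ₐ[ℂ] C) (f : Yangian n →ₐ[ℂ] B) :
    mapT (g.comp f) = (PowerSeries.map (g : B →+* C)).mapMatrix (mapT f) := by
  ext i j r
  rw [coeff_mapT]
  simp [coeff_mapT]

end Lift

/-! ### The Hopf algebra structure -/

section Hopf

attribute [local instance] Yangian.algebra

open MulOpposite Algebra.TensorProduct

variable (n : ℕ)

/-- The embedding of the Yangian as the first tensor factor. -/
abbrev inl : Yangian n →ₐ[ℂ] Yangian n ⊗[ℂ] Yangian n := includeLeft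

/-- The embedding of the Yangian as the second tensor factor. -/
abbrev inr : Yangian n →ₐ[ℂ] Yangian n ⊗[ℂ] Yangian n := includeRight

/-- The two tensor factors commute elementwise, so `IsRTT.mul` applies to the two copies of `T(u)`.
-/
theorem isRTT_comul : IsRTT (mapT (inl n) * mapT (inr n)) :=
  (isRTT_mapT _).mul (isRTT_mapT _) fun i j k l r s => by
    rw [coeff_mapT, coeff_mapT, commute_iff_eq]
    simp

/-- The coproduct of the Yangian. -/
def comul : Yangian n →ₐ[ℂ] Yangian n ⊗[ℂ] Yangian n :=
  lift _ (isRTT_comul n)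

/-- The counit of the Yangian. -/
def counit : Yangian n →ₐ[ℂ] ℂ :=
  lift 1 isRTT_one

theorem mapT_comul : mapT (comul n) = mapT (inl n) * mapT (inr n) :=
  mapT_lift _ _

theorem mapT_counit : mapT (counit n) = 1 :=
  mapT_lift _ _

theorem mapT_comp_comul {C : Type*} [Ring C] [Algebra ℂ C]
    (f : Yangian n ⊗[ℂ] Yangian n →ₐ[ℂ] C) :
    mapT (f.comp (comul n)) = mapT (f.comp (inl n)) * mapT (f.comp (inr n)) := by
  rw [mapT_comp, mapT_comul, map_mul, ← mapT_comp, ← mapT_comp]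

theorem mapT_comp_counit {C : Type*} [Ring C] [Algebra ℂ C] (f : ℂ →ₐ[ℂ] C) :
    mapT (f.comp (counit n)) = 1 := by
  rw [mapT_comp, mapT_counit, map_one]

/-- Both sides send `T(u)` to the product of its three copies in the triple tensor product, so this
is associativity of matrix multiplication. -/
theorem comul_coassoc :
    (Algebra.TensorProduct.assoc ℂ ℂ ℂ (Yangian n) (Yangian n) (Yangian n)).toAlgHom.comp
        ((Algebra.TensorProduct.map (comul n) (.id ℂ (Yangian n))).comp (comul n)) =
      (Algebra.TensorProduct.map (.id ℂ (Yangian n)) (comul n)).comp (comul n) := by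
  apply mapT_injective
  rw [← AlgHom.comp_assoc, mapT_comp_comul, mapT_comp_comul]
  let α := (Algebra.TensorProduct.assoc ℂ ℂ ℂ (Yangian n) (Yangian n) (Yangian n)).toAlgHom
  have h₁ : (α.comp (Algebra.TensorProduct.map (comul n) (.id ℂ (Yangian n)))).comp (inl n) =
      (α.comp includeLeft).comp (comul n) := by
    ext x; simp
  have h₂ : (Algebra.TensorProduct.map (.id ℂ (Yangian n)) (comul n)).comp (inr n) =
      (includeRight : _ →ₐ[ℂ] Yangian n ⊗[ℂ] (Yangian n ⊗[ℂ] Yangian n)).comp (comul n) := by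
    ext x; simp
  rw [h₁, h₂, mapT_comp_comul, mapT_comp_comul, mul_assoc]
  have h₃ : (α.comp includeLeft).comp (inl n) =
      (Algebra.TensorProduct.map (.id ℂ (Yangian n)) (comul n)).comp (inl n) :=
    AlgHom.ext fun x => by simp [α, one_def]
  have h₄ : (α.comp includeLeft).comp (inr n) = includeRight.comp (inl n) :=
    AlgHom.ext fun x => by simp [α]
  have h₅ : (α.comp (Algebra.TensorProduct.map (comul n) (.id ℂ (Yangian n)))).comp (inr n) =
      includeRight.comp (inr n) :=
    AlgHom.ext fun x => by simp [α, one_def]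
  rw [h₃, h₄, h₅]

/-- The counit turns the first copy of `T(u)` into the identity matrix, leaving the second. -/
theorem comul_rTensor :
    (Algebra.TensorProduct.map (counit n) (.id ℂ (Yangian n))).comp (comul n) =
      (Algebra.TensorProduct.lid ℂ (Yangian n)).symm := by
  apply mapT_injective
  have h : (Algebra.TensorProduct.map (counit n) (.id ℂ (Yangian n))).comp (inl n) =
      (includeLeft : ℂ →ₐ[ℂ] ℂ ⊗[ℂ] Yangian n).comp (counit n) := by
    ext x; simp
  rw [mapT_comp_comul, h, mapT_comp_counit, one_mul]
  congr 1
  ext x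
  simp

theorem comul_lTensor :
    (Algebra.TensorProduct.map (.id ℂ (Yangian n)) (counit n)).comp (comul n) =
      (Algebra.TensorProduct.rid ℂ ℂ (Yangian n)).symm := by
  apply mapT_injective
  have h : (Algebra.TensorProduct.map (.id ℂ (Yangian n)) (counit n)).comp (inr n) =
      (includeRight : ℂ →ₐ[ℂ] Yangian n ⊗[ℂ] ℂ).comp (counit n) := by
    ext x; simp
  rw [mapT_comp_comul, h, mapT_comp_counit, mul_one]
  congr 1
  ext x
  simp

/-- The bialgebra structure of the Yangian. -/
abbrev bialgebra : Bialgebra ℂ (Yangian n) :=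
  Bialgebra.ofAlgHom (comul n) (counit n) (comul_coassoc n) (comul_rTensor n) (comul_lTensor n)

/-! ### The antipode and its bijectivity -/

/-- The inverse of `T(u)`. -/
def invT : Matrix (Fin n) (Fin n) (Yangian n)⟦X⟧ :=
  (exists_inverse (T n) (isRTT_T n).coeff_zero).choose

theorem T_mul_invT : T n * invT n = 1 :=
  (exists_inverse (T n) (isRTT_T n).coeff_zero).choose_spec.1

theorem invT_mul_T : invT n * T n = 1 :=
  (exists_inverse (T n) (isRTT_T n).coeff_zero).choose_spec.2

/-- The antipode, as a homomorphism to the opposite algebra. -/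
def antipodeOp : Yangian n →ₐ[ℂ] (Yangian n)ᵐᵒᵖ :=
  lift _ ((isRTT_T n).op_inv (T_mul_invT n) (invT_mul_T n))

/-- The anti-automorphism `T(u) ↦ T(-u)`. -/
def negOp : Yangian n →ₐ[ℂ] (Yangian n)ᵐᵒᵖ :=
  lift _ (isRTT_T n).op_neg

variable {n}

theorem antipodeOp_gen (i j : Fin n) (r : ℕ) :
    antipodeOp n (gen i j r) = op (coeff r (invT n i j)) := by
  rw [antipodeOp, lift_gen, Matrix.of_apply, coeff_mk]

theorem negOp_gen (i j : Fin n) (r : ℕ) :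
    negOp n (gen i j r) = op ((-1) ^ r * gen i j r) := by
  rw [negOp, lift_gen, Matrix.of_apply, coeff_mk, coeff_T]

variable (n)

variable {n} in
theorem unop_map_neg_one_pow_mul (f : Yangian n →ₐ[ℂ] (Yangian n)ᵐᵒᵖ) (r : ℕ) (x : Yangian n) :
    (f ((-1) ^ r * x)).unop = (-1) ^ r * (f x).unop := by
  rw [map_mul, map_pow, map_neg, map_one, unop_mul, unop_pow, unop_neg, unop_one,
    ((Commute.neg_one_left _).pow_left r).eq]

theorem negOp_negOp : (AlgHom.opComm (negOp n)).comp (negOp n) = AlgHom.id ℂ _ := by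
  refine algHom_ext fun i j r => ?_
  change (negOp n (negOp n (gen i j r)).unop).unop = gen i j r
  rw [negOp_gen, unop_op, unop_map_neg_one_pow_mul, negOp_gen, unop_op, neg_one_pow_mul_self]

/-- The automorphism `T(u) ↦ T(-u)⁻¹`. -/
def invNeg : Yangian n →ₐ[ℂ] Yangian n :=
  (AlgHom.opComm (antipodeOp n)).comp (negOp n)

theorem mapT_invNeg : mapT (invNeg n) = evalNeg.mapMatrix (invT n) := by
  ext i j r
  rw [coeff_mapT]
  change (antipodeOp n (negOp n (gen i j r)).unop).unop = coeff r (evalNeg (invT n i j))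
  rw [negOp_gen, unop_op, unop_map_neg_one_pow_mul, antipodeOp_gen, unop_op, coeff_evalNeg]

theorem invNeg_invNeg : (invNeg n).comp (invNeg n) = AlgHom.id ℂ _ := by
  apply mapT_injective
  let f := (PowerSeries.map (invNeg n : Yangian n →+* Yangian n)).mapMatrix (m := Fin n)
  have hT : f (T n) = evalNeg.mapMatrix (invT n) := mapT_invNeg n
  -- `T(-u)` is a left inverse and `f(T⁻¹)` a right inverse of `f(T)`, so they coincide;
  -- substituting `-u` gives the claim.
  have h₁ : evalNeg.mapMatrix (T n) * f (T n) = 1 := by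
    rw [hT, ← map_mul, T_mul_invT, map_one]
  have h₂ : f (T n) * f (invT n) = 1 := by
    rw [← map_mul, T_mul_invT, map_one]
  have h₃ : f (evalNeg.mapMatrix (invT n)) = evalNeg.mapMatrix (f (invT n)) := by
    ext i j : 1
    exact map_evalNeg (invNeg n : Yangian n →+* Yangian n) _
  rw [mapT_comp, mapT_invNeg, mapT_id]
  change f (evalNeg.mapMatrix (invT n)) = T n
  rw [h₃, ← left_inv_eq_right_inv h₁ h₂, mapMatrix_evalNeg_evalNeg]

/-- As `negOp` is involutive, the antipode equals `invNeg` after `negOp`, a composite of two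
involutions of the underlying set. -/
theorem antipodeOp_bijective : Function.Bijective (antipodeOp n) := by
  have h₁ : Function.Involutive fun x => (negOp n x).unop := fun x =>
    DFunLike.congr_fun (negOp_negOp n) x
  have h₂ : Function.Involutive fun x => (antipodeOp n (negOp n x).unop).unop := fun x =>
    DFunLike.congr_fun (invNeg_invNeg n) x
  have h₃ : antipodeOp n = fun x =>
      op ((fun x => (antipodeOp n (negOp n x).unop).unop) ((negOp n x).unop)) := by
    funext x
    exact congrArg (antipodeOp n) (h₁ x).symm
  rw [h₃]
  exact opEquiv.bijective.comp (h₂.bijective.comp h₁.bijective)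

/-- The antipode of the Yangian. -/
def antipode : Yangian n →ₗ[ℂ] Yangian n :=
  (opLinearEquiv ℂ).symm.toLinearMap ∘ₗ (antipodeOp n).toLinearMap

variable {n}

theorem antipode_apply (x : Yangian n) : antipode n x = (antipodeOp n x).unop := rfl

theorem antipode_gen (i j : Fin n) (r : ℕ) : antipode n (gen i j r) = coeff r (invT n i j) := by
  rw [antipode_apply, antipodeOp_gen, unop_op]

theorem antipode_mul (x y : Yangian n) : antipode n (x * y) = antipode n y * antipode n x := by
  simp [antipode_apply]

theorem antipode_algebraMap (c : ℂ) :
    antipode n (algebraMap ℂ (Yangian n) c) = algebraMap ℂ (Yangian n) c := by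
  rw [antipode_apply, AlgHom.commutes]
  rfl

theorem counit_gen (i j : Fin n) (r : ℕ) :
    algebraMap ℂ (Yangian n) (counit n (gen i j r)) =
      coeff r ((1 : Matrix (Fin n) (Fin n) (Yangian n)⟦X⟧) i j) := by
  rw [counit, lift_gen, Matrix.one_apply, Matrix.one_apply]
  split_ifs
  · rw [coeff_one, coeff_one]
    split_ifs
    exacts [map_one _, map_zero _]
  · rw [map_zero, map_zero, map_zero]

theorem comul_gen (i j : Fin n) (r : ℕ) :
    comul n (gen i j r) =
      ∑ a, ∑ p ∈ Finset.HasAntidiagonal.antidiagonal r, gen i a p.1 ⊗ₜ[ℂ] gen a j p.2 := by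
  rw [comul, lift_gen, Matrix.mul_apply, map_sum]
  simp [coeff_mul, coeff_mapT]

/-- Induction on the generators of the Yangian. -/
theorem induction {p : Yangian n → Prop} (hc : ∀ c, p (algebraMap ℂ (Yangian n) c))
    (hg : ∀ i j r, p (gen i j r)) (hadd : ∀ x y, p x → p y → p (x + y))
    (hmul : ∀ x y, p x → p y → p (x * y)) (x : Yangian n) : p x := by
  obtain ⟨x, rfl⟩ : ∃ y, quot n y = x := RingQuot.mkAlgHom_surjective ℂ (Rel n) x
  induction x using FreeAlgebra.induction with
  | grade0 c => rw [AlgHom.commutes]; exact hc c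
  | grade1 x =>
    have := hg x.1 x.2.1 (x.2.2 + 1)
    rwa [← quot_freeGen] at this
  | mul x y hx hy => rw [map_mul]; exact hmul _ _ hx hy
  | add x y hx hy => rw [map_add]; exact hadd _ _ hx hy

/-! ### The antipode axioms -/

/-- The map `x ⊗ y ↦ S(x) y`. -/
def antipodeMul (n : ℕ) : Yangian n ⊗[ℂ] Yangian n →ₗ[ℂ] Yangian n :=
  LinearMap.mul' ℂ (Yangian n) ∘ₗ (antipode n).rTensor (Yangian n)

/-- The map `x ⊗ y ↦ x S(y)`. -/
def mulAntipode (n : ℕ) : Yangian n ⊗[ℂ] Yangian n →ₗ[ℂ] Yangian n :=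
  LinearMap.mul' ℂ (Yangian n) ∘ₗ (antipode n).lTensor (Yangian n)

theorem antipodeMul_tmul (x y : Yangian n) : antipodeMul n (x ⊗ₜ y) = antipode n x * y := by
  simp [antipodeMul]

theorem mulAntipode_tmul (x y : Yangian n) : mulAntipode n (x ⊗ₜ y) = x * antipode n y := by
  simp [mulAntipode]

/-- Since `S` reverses products, `S(ax)by = S(x)(S(a)b)y`: the value at `z` appears nested in the
middle. -/
theorem antipodeMul_mul_tmul (z : Yangian n ⊗[ℂ] Yangian n) (x y : Yangian n) :
    antipodeMul n (z * x ⊗ₜ y) = antipode n x * antipodeMul n z * y := by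
  induction z with
  | zero => simp
  | add z w hz hw => rw [add_mul, map_add, map_add, hz, hw, mul_add, add_mul]
  | tmul a b => rw [tmul_mul_tmul, antipodeMul_tmul, antipodeMul_tmul, antipode_mul]; noncomm_ring

theorem mulAntipode_tmul_mul (z : Yangian n ⊗[ℂ] Yangian n) (x y : Yangian n) :
    mulAntipode n (x ⊗ₜ y * z) = x * mulAntipode n z * antipode n y := by
  induction z with
  | zero => simp
  | add z w hz hw => rw [mul_add, map_add, map_add, hz, hw, mul_add, add_mul]
  | tmul a b => rw [tmul_mul_tmul, mulAntipode_tmul, mulAntipode_tmul, antipode_mul]; noncomm_ring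

/-- A scalar in the middle is central and can be pulled out. With `z = Δ(x)` and `w = Δ(y)` this
makes the antipode axiom multiplicative. -/
theorem antipodeMul_mul {z : Yangian n ⊗[ℂ] Yangian n} {c : ℂ}
    (hz : antipodeMul n z = algebraMap ℂ _ c) (w : Yangian n ⊗[ℂ] Yangian n) :
    antipodeMul n (z * w) = algebraMap ℂ _ c * antipodeMul n w := by
  induction w with
  | zero => simp
  | add v w hv hw => rw [mul_add, map_add, map_add, hv, hw, mul_add]
  | tmul x y => rw [antipodeMul_mul_tmul, hz, antipodeMul_tmul, ← Algebra.commutes, mul_assoc]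

theorem mulAntipode_mul {z : Yangian n ⊗[ℂ] Yangian n} {c : ℂ}
    (hz : mulAntipode n z = algebraMap ℂ _ c) (w : Yangian n ⊗[ℂ] Yangian n) :
    mulAntipode n (w * z) = mulAntipode n w * algebraMap ℂ _ c := by
  induction w with
  | zero => simp
  | add v w hv hw => rw [add_mul, map_add, map_add, hv, hw, add_mul]
  | tmul x y =>
    rw [mulAntipode_tmul_mul, hz, mulAntipode_tmul, mul_assoc, Algebra.commutes, mul_assoc]

theorem antipodeMul_comul (x : Yangian n) :
    antipodeMul n (comul n x) = algebraMap ℂ _ (counit n x) := by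
  induction x using induction with
  | hc c =>
    rw [AlgHom.commutes, AlgHom.commutes, Algebra.TensorProduct.algebraMap_apply,
      antipodeMul_tmul, antipode_algebraMap, mul_one]
    rfl
  | hg i j r =>
    -- On generators the axiom is the coefficient of `u⁻ʳ` in an entry of `T⁻¹T = 1`.
    rw [comul_gen, counit_gen, ← invT_mul_T, Matrix.mul_apply]
    simp only [map_sum, coeff_mul, antipodeMul_tmul, antipode_gen, coeff_T]
  | hadd x y hx hy => simp only [map_add, hx, hy]
  | hmul x y hx hy => rw [map_mul, antipodeMul_mul hx, hy, map_mul, map_mul]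

theorem mulAntipode_comul (x : Yangian n) :
    mulAntipode n (comul n x) = algebraMap ℂ _ (counit n x) := by
  induction x using induction with
  | hc c =>
    rw [AlgHom.commutes, AlgHom.commutes, Algebra.TensorProduct.algebraMap_apply',
      mulAntipode_tmul, antipode_algebraMap, one_mul]
    rfl
  | hg i j r =>
    rw [comul_gen, counit_gen, ← T_mul_invT, Matrix.mul_apply]
    simp only [map_sum, coeff_mul, mulAntipode_tmul, antipode_gen, coeff_T]
  | hadd x y hx hy => simp only [map_add, hx, hy]
  | hmul x y hx hy => rw [map_mul, mulAntipode_mul hy, hx, map_mul, map_mul]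

/-- The Hopf algebra structure of the Yangian. -/
abbrev hopfAlgebra (n : ℕ) : HopfAlgebra ℂ (Yangian n) :=
  { bialgebra n with
    antipode := antipode n
    mul_antipode_rTensor_comul := LinearMap.ext antipodeMul_comul
    mul_antipode_lTensor_comul := LinearMap.ext mulAntipode_comul }

end Hopf

end Yangian

end

theorem mainTheorem3 (n : ℕ) :
    ∃ H : HopfAlgebra ℂ (Yangian n),
      -- the underlying algebra is the Yangian
      H.toAlgebra = Yangian.algebra n ∧
      -- the antipode is an anti-automorphism
      (∃ S : Yangian n ≃ₐ[ℂ] (Yangian n)ᵐᵒᵖ,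
        ∀ y : Yangian n, S y = MulOpposite.op (HopfAlgebra.antipode ℂ y)) ∧
      -- coproduct
      (∀ i j : Fin n,
        Matrix.mapCoeff (Coalgebra.comul (R := ℂ) (A := Yangian n)) (Yangian.T n) i j =
          ∑ a : Fin n,
            PowerSeries.map
                (Algebra.TensorProduct.includeLeftRingHom :
                  Yangian n →+* Yangian n ⊗[ℂ] Yangian n)
                (Yangian.T n i a) *
              PowerSeries.map
                ((Algebra.TensorProduct.includeRight :
                  Yangian n →ₐ[ℂ] Yangian n ⊗[ℂ] Yangian n) :
                  Yangian n →+* Yangian n ⊗[ℂ] Yangian n)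
                (Yangian.T n a j)) ∧
      -- antipode: the image of `T(u)` is the two-sided inverse of `T(u)`
      (Yangian.T n * Matrix.mapCoeff (HopfAlgebra.antipode ℂ) (Yangian.T n) = 1 ∧
        Matrix.mapCoeff (HopfAlgebra.antipode ℂ) (Yangian.T n) * Yangian.T n = 1) ∧
      -- counit
      Matrix.mapCoeff (Coalgebra.counit (R := ℂ) (A := Yangian n)) (Yangian.T n) = 1 := by
  -- The Hopf structure is built over the algebra structure of the presentation, which makes the
  -- first condition definitional.
  refine ⟨Yangian.hopfAlgebra n, rfl, ⟨letI := Yangian.algebra n;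
    AlgEquiv.ofBijective (Yangian.antipodeOp n) (Yangian.antipodeOp_bijective n), fun y => rfl⟩,
    ?_, ?_, ?_⟩
  · intro i j
    ext r
    refine (Yangian.coeff_mapCoeff _ _ i j r).trans ?_
    rw [Yangian.coeff_T]
    refine (Yangian.lift_gen _ (Yangian.isRTT_comul n) i j r).trans ?_
    rw [Matrix.mul_apply]
    rfl
  · have h : Matrix.mapCoeff (Yangian.antipode n) (Yangian.T n) = Yangian.invT n := by
      ext i j r
      refine (Yangian.coeff_mapCoeff _ _ i j r).trans ?_
      rw [Yangian.coeff_T, Yangian.antipode_gen]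
    exact ⟨(congrArg (Yangian.T n * ·) h).trans (Yangian.T_mul_invT n),
      (congrArg (· * Yangian.T n) h).trans (Yangian.invT_mul_T n)⟩
  · ext i j r
    refine (Yangian.coeff_mapCoeff _ _ i j r).trans ?_
    rw [Yangian.coeff_T]
    exact Yangian.lift_gen _ Yangian.isRTT_one i j r
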